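/- Let $q$ be an indeterminate. For $0\le k\le n$ let $\begin{bmatrix} n\\ k\end{bmatrix}_q=\dfrac{(q;q)_n}{(q;q)_k\,(q;q)_{n-k}}$, where $(a;q)_m=\prod_{i=0}^{m-1}(1-aq^i)$; let $[m]_q=(1-q^m)/(1-q)$, and let $$C_k(q)=\frac{1}{[k+1]_q}\begin{bmatrix} 2k\\ k\end{bmatrix}_q$$ be the $q$-Catalan numbers, which are polynomials in $q$ with integer coefficients. Let $\Phi_n(q)$ be the $n$th cyclotomic polynomial. Theorem. For every positive integer $n$, the following congruences hold modulo $\Phi_n(q)^2$ in $\mathbb{Z}[q]$: $$\sum_{k=0}^{n-1}q^kC_k(q)\equiv \begin{cases} -q^{\frac{n^2-1}{3}}-q^{\frac{n(2n-1)}{3}} & \text{if } n\equiv 2\pmod 3,\\[4pt] q^{\frac{n^2-1}{3}}-\frac{n-1}{3}\,(q^n-1) & \text{if } n\equiv 1\pmod 3. \end{cases}$$ -/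

import Mathlib

open Polynomial

noncomputable section

namespace QCatalan

/-- The indeterminate `q`, as an element of the field of fractions of `ℤ[q]`, which is the
field `ℚ(q)` of rational functions. -/
def q : RatFunc ℤ := RatFunc.X

/-- The `q`-shifted factorial `(a;q)_n = (1 - a)(1 - a q) ⋯ (1 - a q^(n-1))`. -/
def qShifted (a : RatFunc ℤ) (n : ℕ) : RatFunc ℤ := ∏ i ∈ Finset.range n, (1 - a * q ^ i)

/-- The `q`-integer `[n]_q = (1 - q^n) / (1 - q)`. -/
def qInt (n : ℕ) : RatFunc ℤ := (1 - q ^ n) / (1 - q)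

/-- The `q`-binomial coefficient, equal to `(q;q)_n / ((q;q)_k (q;q)_(n-k))` for `0 ≤ k ≤ n`
and to `0` otherwise. The denominators are nonzero since `q` is an indeterminate. -/
def qBinom (n k : ℕ) : RatFunc ℤ :=
  if k ≤ n then qShifted q n / (qShifted q k * qShifted q (n - k)) else 0

/-- The `q`-Catalan number `C_n(q)`, the central `q`-binomial coefficient over `[n+1]_q`. -/
def qCatalan (n : ℕ) : RatFunc ℤ := qBinom (2 * n) n / qInt (n + 1)

/-- `A ≡ B (mod P)`: the difference `A - B` is a polynomial with integer coefficients which is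
divisible by `P` in `ℤ[q]`. -/
def QCongr (A B : RatFunc ℤ) (P : ℤ[X]) : Prop :=
  ∃ g : ℤ[X], A - B = algebraMap ℤ[X] (RatFunc ℤ) (P * g)

end QCatalan

end

/-! The ratio of adjacent Gaussian binomials gives C_k = [2k,k] - q[2k,k+1], so the sum is S_0 - q
S_1 with S_s = ∑ q^k [2k,k+s] (`sum_qCatalan_eq`). A telescoping induction
(`sum_gaussBinom_central`) turns S_s into a combination of the [2n,n+j] with j = 3m+s+1 and j =
3m+s+2.

Let z be a primitive n-th root of unity. Divisibility by Φ_n² follows once the value and the Euler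
derivative X·d/dX vanish at z (`cyclotomic_sq_dvd`). For 0 < j < n, [2n,n+j] vanishes at z and its
Euler derivative is an explicit fraction with denominator 1 - z^j (`eulerDeriv_central`); the terms
with j = n are monomials.

It remains to sum these fractions. With z = η² and η^n = -1, signs become powers of η, and reducing
indices modulo n up to sign identifies three of the four sums with multiples of `altSum` at h = η³.
By `altSum_eq` and `altSum_succ_eq` that sum collapses to -∑ 1/(1 - z^(3l)) over an interval
symmetric under l ↦ n - l, where the terms pair to 1. The fourth sum cancels within itself. -/

namespace QCatalan

/-! ### Gaussian binomials without division. -/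

section GaussBinom

variable {R : Type*} [CommRing R]

/-- The Gaussian binomial coefficient at an element `x` of a commutative ring, defined by the
`q`-Pascal recursion. -/
def gaussBinom (x : R) : ℕ → ℕ → R
  | _, 0 => 1
  | 0, _ + 1 => 0
  | n + 1, k + 1 => gaussBinom x n k + x ^ (k + 1) * gaussBinom x n (k + 1)

variable (x : R)

@[simp] lemma gaussBinom_zero_right (n : ℕ) : gaussBinom x n 0 = 1 := by
  cases n <;> rfl

@[simp] lemma gaussBinom_zero_succ (k : ℕ) : gaussBinom x 0 (k + 1) = 0 := rfl

lemma gaussBinom_succ_succ (n k : ℕ) :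
    gaussBinom x (n + 1) (k + 1) = gaussBinom x n k + x ^ (k + 1) * gaussBinom x n (k + 1) := rfl

lemma gaussBinom_eq_zero {n k : ℕ} (h : n < k) : gaussBinom x n k = 0 := by
  induction n generalizing k with
  | zero => obtain ⟨k, rfl⟩ := Nat.exists_eq_succ_of_ne_zero h.ne'; rfl
  | succ n ih =>
    obtain ⟨k, rfl⟩ := Nat.exists_eq_succ_of_ne_zero (by omega : k ≠ 0)
    rw [Nat.succ_eq_add_one, gaussBinom_succ_succ, ih (by omega), ih (by omega)]
    simp

@[simp] lemma gaussBinom_self (n : ℕ) : gaussBinom x n n = 1 := by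
  induction n with
  | zero => rfl
  | succ n ih => rw [gaussBinom_succ_succ, ih, gaussBinom_eq_zero x (Nat.lt_succ_self n)]; simp

lemma map_gaussBinom {S : Type*} [CommRing S] (f : R →+* S) (n k : ℕ) :
    f (gaussBinom x n k) = gaussBinom (f x) n k := by
  induction n generalizing k with
  | zero => cases k <;> simp
  | succ n ih => cases k <;> simp [gaussBinom_succ_succ, ih]

/-- The ratio of horizontally adjacent Gaussian binomial coefficients, without division. -/
lemma gaussBinom_ratio (n k : ℕ) :
    (x ^ k - x ^ n) * gaussBinom x n k =
      x ^ k * (1 - x ^ (k + 1)) * gaussBinom x n (k + 1) := by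
  induction n generalizing k with
  | zero =>
    cases k with
    | zero => simp
    | succ k => simp
  | succ n ih =>
    cases k with
    | zero =>
      have h := ih 0
      simp only [gaussBinom_succ_succ, gaussBinom_zero_right, pow_zero] at h ⊢
      linear_combination x * h
    | succ k =>
      rw [gaussBinom_succ_succ, gaussBinom_succ_succ]
      linear_combination x * ih k + x ^ (k + 2) * ih (k + 1)

lemma gaussBinom_succ_succ' (n k : ℕ) :
    x ^ k * gaussBinom x (n + 1) (k + 1) =
      x ^ n * gaussBinom x n k + x ^ k * gaussBinom x n (k + 1) := by
  rw [gaussBinom_succ_succ]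
  linear_combination gaussBinom_ratio x n k

lemma one_sub_pow_mul_gaussBinom (n k : ℕ) :
    (1 - x ^ (k + 1)) * gaussBinom x (n + 1) (k + 1) = (1 - x ^ (n + 1)) * gaussBinom x n k := by
  rw [gaussBinom_succ_succ]
  linear_combination -x * gaussBinom_ratio x n k

/-- Both Pascal rules applied in turn. The factor x^(n+j) clears the power x^(n-j), whose exponent
may be negative. -/
lemma gaussBinom_central_succ (n j : ℕ) :
    x ^ (n + j) * gaussBinom x (2 * (n + 1)) (n + 1 + (j + 1)) =
      x ^ (n + j) * (1 + x ^ (2 * n + 1)) * gaussBinom x (2 * n) (n + (j + 1)) +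
        x ^ (2 * n) * gaussBinom x (2 * n) (n + j) +
        x ^ (n + j) * x ^ (n + j + 2) * gaussBinom x (2 * n) (n + (j + 2)) := by
  have h1 := gaussBinom_succ_succ x (2 * n + 1) (n + j + 1)
  have h2 := gaussBinom_succ_succ' x (2 * n) (n + j)
  have h3 := gaussBinom_succ_succ' x (2 * n) (n + j + 1)
  have e1 : 2 * (n + 1) = 2 * n + 1 + 1 := by ring
  have e2 : n + 1 + (j + 1) = n + j + 1 + 1 := by ring
  rw [e1, e2, h1, ← add_assoc n j 1, ← add_assoc n j 2]
  linear_combination h2 + x ^ (n + j + 1) * h3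

end GaussBinom

/-! ### Telescoping expansion of the central sums. -/

section CentralSum

variable {R : Type*} [CommRing R] [IsDomain R] {x : R}

/-- The increment in n has two boundary terms, at j and j + 3. Stepping j by 3 and e by 4j + 6 makes
consecutive ones cancel; e = 6m² + 4sm with j = 3m + s does this. -/
lemma gaussBinom_central_pair (hx : x ≠ 0) (n j e : ℕ) :
    x ^ (e + j) * (gaussBinom x (2 * (n + 1)) (n + 1 + (j + 1))
        - x ^ (2 * j + 3) * gaussBinom x (2 * (n + 1)) (n + 1 + (j + 2))) =
      x ^ (e + j) * (gaussBinom x (2 * n) (n + (j + 1))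
        - x ^ (2 * j + 3) * gaussBinom x (2 * n) (n + (j + 2))) +
      (x ^ (e + n) * gaussBinom x (2 * n) (n + j)
        - x ^ (e + n + (4 * j + 6)) * gaussBinom x (2 * n) (n + (j + 3))) := by
  have h1 := gaussBinom_central_succ x n j
  have h2 := gaussBinom_central_succ x n (j + 1)
  have h3 := gaussBinom_ratio x (2 * n) (n + (j + 1))
  refine mul_left_cancel₀ (pow_ne_zero (n + 1) hx) ?_
  simp only [show n + (j + 1) + 1 = n + (j + 2) by ring, add_assoc, Nat.reduceAdd] at h1 h2 h3 ⊢
  linear_combination x ^ (e + 1) * h1 - x ^ (e + 2 * j + 3) * h2 - x ^ (e + j + n + 2) * h3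

lemma sum_gaussBinom_central (hx : x ≠ 0) (s M n : ℕ) (hn : n ≤ 3 * M + s) :
    ∑ k ∈ Finset.range n, x ^ k * gaussBinom x (2 * k) (k + s) =
      ∑ m ∈ Finset.range M, x ^ (6 * m ^ 2 + 4 * s * m + (3 * m + s)) *
        (gaussBinom x (2 * n) (n + (3 * m + s + 1)) -
          x ^ (2 * (3 * m + s) + 3) * gaussBinom x (2 * n) (n + (3 * m + s + 2))) := by
  induction n with
  | zero =>
    symm
    simp only [Finset.range_zero, Finset.sum_empty]
    refine Finset.sum_eq_zero fun m _ => ?_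
    rw [gaussBinom_eq_zero _ (by omega), gaussBinom_eq_zero _ (by omega)]
    ring
  | succ n ih =>
    rw [Finset.sum_range_succ, ih (by omega)]
    simp only [gaussBinom_central_pair hx n]
    rw [Finset.sum_add_distrib]
    congr 1
    -- Telescoping in m leaves x^n [2n,n+s]; the upper boundary term vanishes because n < 3M + s.
    have := Finset.sum_range_sub' (fun m => x ^ (6 * m ^ 2 + 4 * s * m + n) *
      gaussBinom x (2 * n) (n + (3 * m + s))) M
    rw [gaussBinom_eq_zero x (by omega : 2 * n < n + (3 * M + s))] at this
    simp only [mul_zero, sub_zero, zero_add, ne_eq, OfNat.ofNat_ne_zero, not_false_eq_true,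
      zero_pow] at this
    rw [← this]
    refine Finset.sum_congr rfl fun m _ => ?_
    congr 3 <;> ring

end CentralSum

/-! ### From q-Catalan numbers to integer polynomials. -/

section RatFunc

lemma q_pow_ne_one {n : ℕ} (hn : n ≠ 0) : (1 : RatFunc ℤ) - q ^ n ≠ 0 := by
  have h : (1 : ℤ[X]) - X ^ n ≠ 0 := by
    intro h
    have := congrArg (fun p : ℤ[X] => p.coeff n) h
    simp [coeff_one, hn] at this
  have := (map_ne_zero_iff _ (IsFractionRing.injective ℤ[X] (RatFunc ℤ))).2 h
  simpa [q] using this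

lemma q_ne_zero : q ≠ 0 := by
  rw [q, ← RatFunc.algebraMap_X]
  exact (map_ne_zero_iff _ (IsFractionRing.injective ℤ[X] (RatFunc ℤ))).2 X_ne_zero

lemma qShifted_q_ne_zero (n : ℕ) : qShifted q n ≠ 0 := by
  refine Finset.prod_ne_zero_iff.2 fun i _ => ?_
  rw [← pow_succ']
  exact q_pow_ne_one i.succ_ne_zero

lemma qShifted_q_succ (n : ℕ) : qShifted q (n + 1) = qShifted q n * (1 - q ^ (n + 1)) := by
  rw [qShifted, Finset.prod_range_succ, ← pow_succ']
  rfl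

lemma gaussBinom_mul_qShifted (a b : ℕ) :
    gaussBinom q (a + b) a * (qShifted q a * qShifted q b) = qShifted q (a + b) := by
  induction a generalizing b with
  | zero => simp [qShifted]
  | succ a ih =>
    have h := gaussBinom_ratio q (a + 1 + b) a
    have h2 := ih (b + 1)
    rw [show a + (b + 1) = a + 1 + b by ring, qShifted_q_succ b] at h2
    rw [qShifted_q_succ a, ← h2]
    refine mul_left_cancel₀ (pow_ne_zero a q_ne_zero) ?_
    linear_combination -(qShifted q a * qShifted q b) * h

lemma qBinom_eq_gaussBinom (n k : ℕ) : qBinom n k = gaussBinom q n k := by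
  unfold qBinom
  split_ifs with h
  · obtain ⟨b, rfl⟩ := Nat.exists_eq_add_of_le h
    rw [Nat.add_sub_cancel_left, div_eq_iff
      (mul_ne_zero (qShifted_q_ne_zero _) (qShifted_q_ne_zero _)), gaussBinom_mul_qShifted]
  · rw [gaussBinom_eq_zero _ (by omega)]

/-- Since [2k,k+1] is [k]_q/[k+1]_q times [2k,k], this reduces to [k+1]_q - q[k]_q = 1. -/
lemma qCatalan_eq (k : ℕ) :
    qCatalan k = gaussBinom q (2 * k) k - q * gaussBinom q (2 * k) (k + 1) := by
  have h1 := q_pow_ne_one (n := k + 1) (by omega)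
  have h2 : 1 - q ≠ 0 := by simpa using q_pow_ne_one one_ne_zero
  have h := gaussBinom_ratio q (2 * k) k
  rw [qCatalan, qInt, qBinom_eq_gaussBinom, div_eq_iff (div_ne_zero h1 h2), mul_div_assoc',
    eq_div_iff h2]
  refine mul_left_cancel₀ (pow_ne_zero k q_ne_zero) ?_
  linear_combination -q * h

lemma sum_qCatalan_eq (n : ℕ) :
    ∑ k ∈ Finset.range n, q ^ k * qCatalan k = algebraMap ℤ[X] (RatFunc ℤ)
      (∑ k ∈ Finset.range n, X ^ k * gaussBinom X (2 * k) (k + 0) -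
        X * ∑ k ∈ Finset.range n, X ^ k * gaussBinom X (2 * k) (k + 1)) := by
  simp only [map_sub, map_mul, map_sum, map_pow, map_gaussBinom, RatFunc.algebraMap_X,
    Finset.mul_sum]
  rw [← Finset.sum_sub_distrib]
  refine Finset.sum_congr rfl fun k _ => ?_
  rw [qCatalan_eq, q, add_zero]
  ring

end RatFunc

/-! ### Divisibility by the squared cyclotomic polynomial. -/

section Cyclotomic

/-- The value at `z` of `X` times the derivative of `f`. -/
noncomputable def eulerDeriv (z : ℂ) : ℤ[X] →+ ℂ :=
  ((AddMonoidHom.mulLeft z).comp (aeval z).toRingHom.toAddMonoidHom).comp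
    (derivative (R := ℤ)).toAddMonoidHom

lemma eulerDeriv_apply (z : ℂ) (f : ℤ[X]) : eulerDeriv z f = z * aeval z (derivative f) := rfl

lemma eulerDeriv_mul (z : ℂ) (f g : ℤ[X]) :
    eulerDeriv z (f * g) = eulerDeriv z f * aeval z g + aeval z f * eulerDeriv z g := by
  simp only [eulerDeriv_apply, derivative_mul, map_add, map_mul]
  ring

@[simp] lemma eulerDeriv_X_pow (z : ℂ) (n : ℕ) : eulerDeriv z (X ^ n) = n * z ^ n := by
  cases n with
  | zero => simp [eulerDeriv_apply]
  | succ n => simp [eulerDeriv_apply]; ring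

@[simp] lemma eulerDeriv_X (z : ℂ) : eulerDeriv z X = z := by simp [eulerDeriv_apply]

@[simp] lemma eulerDeriv_one (z : ℂ) : eulerDeriv z 1 = 0 := by simp [eulerDeriv_apply]

@[simp] lemma eulerDeriv_natCast (z : ℂ) (n : ℕ) : eulerDeriv z n = 0 := by
  simp [eulerDeriv_apply]

/-- Writing f = Φ_n g, the Euler derivative at z is zΦ_n'(z)g(z); separability forces g(z) = 0, so
Φ_n, the minimal polynomial of z, divides g. -/
lemma cyclotomic_sq_dvd {n : ℕ} (hn : 0 < n) {z : ℂ} (hz : IsPrimitiveRoot z n) {f : ℤ[X]}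
    (h0 : aeval z f = 0) (h1 : eulerDeriv z f = 0) : cyclotomic n ℤ ^ 2 ∣ f := by
  have hdvd : ∀ g : ℤ[X], aeval z g = 0 → cyclotomic n ℤ ∣ g := fun g hg => by
    rw [cyclotomic_eq_minpoly hz hn]
    exact minpoly.isIntegrallyClosed_dvd (hz.isIntegral hn) hg
  have hc : aeval z (cyclotomic n ℤ) = 0 := by
    rw [cyclotomic_eq_minpoly hz hn, minpoly.aeval]
  obtain ⟨g, rfl⟩ := hdvd f h0
  rw [eulerDeriv_mul, hc, zero_mul, add_zero, eulerDeriv_apply] at h1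
  have hsep : aeval z (derivative (cyclotomic n ℤ)) ≠ 0 := by
    have : NeZero (n : ℂ) := ⟨Nat.cast_ne_zero.2 hn.ne'⟩
    have hs : (cyclotomic n ℂ).Separable := separable_cyclotomic n ℂ
    have hr : aeval z (cyclotomic n ℂ) = 0 := by
      rw [← map_cyclotomic_int n ℂ, ← algebraMap_int_eq, aeval_map_algebraMap, hc]
    have := hs.aeval_derivative_ne_zero hr
    rwa [← map_cyclotomic_int n ℂ, ← algebraMap_int_eq, derivative_map,
      aeval_map_algebraMap] at this
  have hz0 : z ≠ 0 := hz.ne_zero hn.ne'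
  rw [sq]
  exact mul_dvd_mul_left _ (hdvd g ((mul_eq_zero.1 h1).resolve_left (mul_ne_zero hz0 hsep)))

end Cyclotomic

/-! ### Evaluation of the alternating sum. -/

section HarmonicSum

variable {K : Type*} [Field K]

/-- The alternating sum `∑ (-1)^l h^(l (l + 1 - 2N)) / (1 - h^(2l))` over `1 ≤ l ≤ M`. -/
def altSum (h : K) (N M : ℕ) : K :=
  ∑ i ∈ Finset.range M,
    (-1) ^ (i + 1) * h ^ ((i + 1) * (i + 2 - 2 * N) : ℤ) / (1 - h ^ (2 * (i + 1)))

/-- The reflection i ↦ 2N - 1 - i preserves the exponent and reverses the sign. -/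
lemma sum_alternating_theta (h : ℂ) (N : ℕ) :
    ∑ i ∈ Finset.range (2 * N), (-1 : ℂ) ^ (i + 1) * h ^ ((i + 1) * (i - 2 * N) : ℤ) = 0 := by
  rw [← self_eq_neg]
  conv_lhs => rw [← Finset.sum_range_reflect]
  rw [← Finset.sum_neg_distrib]
  refine Finset.sum_congr rfl fun i hi => ?_
  have hi := Finset.mem_range.1 hi
  obtain ⟨d, hd⟩ : ∃ d, 2 * N = i + d + 1 := ⟨2 * N - i - 1, by omega⟩
  have hpar : (-1 : ℂ) ^ (d + 1) = -(-1) ^ (i + 1) := by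
    rcases Nat.even_or_odd i with he | ho
    · have : Odd d := by
        by_contra h; rw [Nat.not_odd_iff_even] at h
        rcases he with ⟨a, rfl⟩; rcases h with ⟨b, rfl⟩; omega
      rw [this.add_one.neg_one_pow, he.add_one.neg_one_pow, neg_neg]
    · have : Even d := by
        by_contra h; rw [Nat.not_even_iff_odd] at h
        rcases ho with ⟨a, rfl⟩; rcases h with ⟨b, rfl⟩; omega
      rw [this.add_one.neg_one_pow, ho.add_one.neg_one_pow]
  have hz : (2 * N : ℤ) = i + d + 1 := by exact_mod_cast hd
  rw [hz, show 2 * N - 1 - i = d by omega, hpar, neg_mul]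
  congr 3
  ring

variable {h : ℂ}

/-- In each termwise difference the denominator cancels, leaving the vanishing theta sum. -/
lemma altSum_shift (N : ℕ) (h0 : h ≠ 0) (hh : ∀ l, 0 < l → l ≤ 2 * N → h ^ (2 * l) ≠ 1) :
    altSum h (N + 1) (2 * N) = altSum h N (2 * N) := by
  rw [← sub_eq_zero, ← sum_alternating_theta h N, altSum, altSum, ← Finset.sum_sub_distrib]
  refine Finset.sum_congr rfl fun i hi => ?_
  have hi := Finset.mem_range.1 hi
  have h1 : 1 - h ^ (2 * (i + 1)) ≠ 0 := sub_ne_zero.2 (hh (i + 1) (by omega) (by omega)).symm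
  have e1 : ((i + 1) * (i + 2 - 2 * N) : ℤ) = (i + 1) * (i - 2 * N) + (2 * (i + 1) : ℕ) := by
    push_cast; ring
  have e2 : ((i + 1) * (i + 2 - 2 * (N + 1 : ℕ)) : ℤ) = (i + 1) * (i - 2 * N) := by
    push_cast; ring
  rw [e1, e2, zpow_add₀ h0, zpow_natCast, ← sub_div, div_eq_iff h1]
  ring

/-- The alternating sum of length `2N`, and its extension by one term, are sums over the upper
half range. -/
lemma altSum_eq (N : ℕ) (h0 : h ≠ 0) (hh : ∀ l, 0 < l → l ≤ 2 * N → h ^ (2 * l) ≠ 1) :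
    altSum h N (2 * N) = -∑ k ∈ Finset.range N, 1 / (1 - h ^ (2 * (N + 1 + k))) := by
  induction N with
  | zero => simp [altSum]
  | succ N ih =>
    have ih := ih fun l hl hl' => hh l hl (by omega)
    have hs := altSum_shift N h0 fun l hl hl' => hh l hl (by omega)
    have hne : ∀ l, 0 < l → l ≤ 2 * (N + 1) → 1 - h ^ (2 * l) ≠ 0 := fun l hl hl' =>
      sub_ne_zero.2 (hh l hl hl').symm
    rw [show 2 * (N + 1) = 2 * N + 1 + 1 by ring, altSum, Finset.sum_range_succ,
      Finset.sum_range_succ, ← altSum, hs, ih]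
    have hR : ∑ k ∈ Finset.range N, 1 / (1 - h ^ (2 * (N + 1 + k))) +
        1 / (1 - h ^ (2 * (2 * N + 1))) + 1 / (1 - h ^ (2 * (2 * N + 2))) =
        ∑ k ∈ Finset.range (N + 1), 1 / (1 - h ^ (2 * (N + 1 + 1 + k))) +
        1 / (1 - h ^ (2 * (N + 1))) := by
      have := Finset.sum_range_succ' (fun k => 1 / (1 - h ^ (2 * (N + 1 + k)))) (N + 1)
      rw [Finset.sum_range_succ, Finset.sum_range_succ] at this
      convert this using 3 <;> ring_nf
    have e1 : (((2 * N : ℕ) + 1) * ((2 * N : ℕ) + 2 - 2 * (N + 1 : ℕ)) : ℤ) = 0 := by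
      push_cast; ring
    have e2 : (((2 * N + 1 : ℕ) + 1) * ((2 * N + 1 : ℕ) + 2 - 2 * (N + 1 : ℕ)) : ℤ) =
        (2 * (N + 1) : ℕ) := by push_cast; ring
    rw [e1, e2, zpow_natCast, zpow_zero, eq_sub_of_add_eq hR.symm]
    have hn1 := hne (2 * N + 1) (by omega) (by omega)
    have hn2 := hne (2 * N + 2) (by omega) (by omega)
    have hn3 := hne (N + 1) (by omega) (by omega)
    rw [show 2 * N + 1 + 1 = 2 * N + 2 by ring] at *
    -- With y = h^(2(N+1)), the last new term is y/(1 - y²) = 1/(1 - y) - 1/(1 - y²): it removes the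
    -- lower end of the range and adds the new upper end.
    have e3 : 1 - h ^ (2 * (2 * N + 2)) = (1 - h ^ (2 * (N + 1))) * (1 + h ^ (2 * (N + 1))) := by
      ring
    rw [e3] at hn2 ⊢
    have hn4 := right_ne_zero_of_mul hn2
    have p1 : (-1 : ℂ) ^ (2 * N + 1) = -1 := Odd.neg_one_pow ⟨N, rfl⟩
    have p2 : (-1 : ℂ) ^ (2 * N + 2) = 1 := Even.neg_one_pow ⟨N + 1, by ring⟩
    rw [p1, p2]
    generalize h ^ (2 * (N + 1)) = y at *
    generalize h ^ (2 * (2 * N + 1)) = w at *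
    field_simp
    ring

lemma altSum_succ_eq (N : ℕ) (h0 : h ≠ 0) (hh : ∀ l, 0 < l → l ≤ 2 * N + 1 → h ^ (2 * l) ≠ 1) :
    altSum h (N + 1) (2 * N + 1) =
      -∑ k ∈ Finset.range (N + 1), 1 / (1 - h ^ (2 * (N + 1 + k))) := by
  have e1 : (((2 * N : ℕ) + 1) * ((2 * N : ℕ) + 2 - 2 * (N + 1 : ℕ)) : ℤ) = 0 := by
    push_cast; ring
  rw [altSum, Finset.sum_range_succ, ← altSum,
    altSum_shift N h0 fun l hl hl' => hh l hl (by omega),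
    altSum_eq N h0 fun l hl hl' => hh l hl (by omega), e1, Finset.sum_range_succ, zpow_zero,
    Odd.neg_one_pow ⟨N, rfl⟩, show N + 1 + N = 2 * N + 1 by ring]
  ring

/-- Reflected terms pair up by 1/(1 - x) + 1/(1 - x⁻¹) = 1. -/
lemma sum_one_div_one_sub_of_reflect (K : ℕ) (x : ℕ → ℂ) (h1 : ∀ k < K, x k ≠ 1)
    (hx : ∀ k < K, x k * x (K - 1 - k) = 1) :
    ∑ k ∈ Finset.range K, 1 / (1 - x k) = K / 2 := by
  have h2 : ∑ k ∈ Finset.range K, (1 / (1 - x k) + 1 / (1 - x (K - 1 - k))) = K := by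
    rw [Finset.sum_congr rfl (g := fun _ => (1 : ℂ)), Finset.sum_const, Finset.card_range,
      nsmul_eq_mul, mul_one]
    intro k hk
    have hk := Finset.mem_range.1 hk
    have a1 := sub_ne_zero.2 (h1 k hk).symm
    have a2 := sub_ne_zero.2 (h1 (K - 1 - k) (by omega)).symm
    rw [div_add_div _ _ a1 a2, div_eq_one_iff_eq (mul_ne_zero a1 a2)]
    linear_combination -hx k hk
  rw [Finset.sum_add_distrib,
    Finset.sum_range_reflect (fun k => 1 / (1 - x k)) K] at h2
  linear_combination h2 / 2

lemma altSum_of_isPrimitiveRoot (N : ℕ) (hp : IsPrimitiveRoot (h ^ 2) (3 * N + 1)) :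
    altSum h N (2 * N) = -(N / 2) := by
  have h0 : h ≠ 0 := fun h => by
    simpa [h] using hp.ne_zero (by omega)
  have hh : ∀ l, 0 < l → l ≤ 2 * N → h ^ (2 * l) ≠ 1 := fun l hl hl' => by
    rw [pow_mul]; exact hp.pow_ne_one_of_pos_of_lt (by omega) (by omega)
  rw [altSum_eq N h0 hh, sum_one_div_one_sub_of_reflect N (fun k => h ^ (2 * (N + 1 + k)))]
  · exact fun k hk => hh _ (by omega) (by omega)
  · intro k hk
    rw [← pow_add, show 2 * (N + 1 + k) + 2 * (N + 1 + (N - 1 - k)) = 2 * (3 * N + 1) by omega,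
      pow_mul, hp.pow_eq_one]

lemma altSum_succ_of_isPrimitiveRoot (N : ℕ) (hp : IsPrimitiveRoot (h ^ 2) (3 * N + 2)) :
    altSum h (N + 1) (2 * N + 1) = -((N + 1) / 2) := by
  have h0 : h ≠ 0 := fun h => by
    simpa [h] using hp.ne_zero (by omega)
  have hh : ∀ l, 0 < l → l ≤ 2 * N + 1 → h ^ (2 * l) ≠ 1 := fun l hl hl' => by
    rw [pow_mul]; exact hp.pow_ne_one_of_pos_of_lt (by omega) (by omega)
  rw [altSum_succ_eq N h0 hh,
    sum_one_div_one_sub_of_reflect (N + 1) (fun k => h ^ (2 * (N + 1 + k)))]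
  · push_cast; rfl
  · exact fun k hk => hh _ (by omega) (by omega)
  · intro k hk
    rw [← pow_add, show 2 * (N + 1 + k) + 2 * (N + 1 + (N + 1 - 1 - k)) = 2 * (3 * N + 2) by omega,
      pow_mul, hp.pow_eq_one]

end HarmonicSum

/-! ### Calculus of fractions in a root η with η^n = -1. -/

section RootFraction

/-- The fraction `η^a / (1 - η^(2b))`. -/
noncomputable def rootFrac (η : ℂ) (a b : ℤ) : ℂ := η ^ a / (1 - η ^ (2 * b))

variable {η : ℂ} {n : ℕ}

lemma zpow_eq_of_eq_add (h0 : η ≠ 0) (hη : η ^ n = -1) {a a' : ℤ} (u : ℤ)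
    (h : a = a' + 2 * n * u) : η ^ a = η ^ a' := by
  rw [h, zpow_add₀ h0, zpow_mul, mul_comm (2 : ℤ), zpow_mul, zpow_natCast, hη]
  simp

lemma zpow_natCast_mul (hη : η ^ n = -1) (k : ℕ) : η ^ ((n : ℤ) * k) = (-1) ^ k := by
  rw [zpow_mul, zpow_natCast, zpow_natCast, hη]

lemma rootFrac_neg (h0 : η ≠ 0) (hη : η ^ n = -1) (a b : ℤ) :
    -rootFrac η a b = rootFrac η (a + n) b := by
  rw [rootFrac, rootFrac, zpow_add₀ h0, zpow_natCast, hη]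
  ring

lemma rootFrac_eq (h0 : η ≠ 0) (hη : η ^ n = -1) {a a' b b' : ℤ} (u v : ℤ)
    (ha : a = a' + 2 * n * u) (hb : b = b' + n * v) : rootFrac η a b = rootFrac η a' b' := by
  rw [rootFrac, rootFrac, zpow_eq_of_eq_add h0 hη u ha,
    zpow_eq_of_eq_add h0 hη (a := 2 * b) (a' := 2 * b') v (by rw [hb]; ring)]

/-- 1/(1 - y⁻¹) = -y/(1 - y), with the sign absorbed as η^n. -/
lemma rootFrac_flip (h0 : η ≠ 0) (hη : η ^ n = -1) (a b : ℤ) :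
    rootFrac η a (-b) = rootFrac η (a + n + 2 * b) b := by
  have hy : η ^ (2 * b) ≠ 0 := zpow_ne_zero _ h0
  rw [rootFrac, rootFrac, zpow_add₀ h0, zpow_add₀ h0, zpow_natCast, hη, mul_neg (2 : ℤ), zpow_neg]
  generalize η ^ (2 * b) = y at *
  by_cases h1 : y = 1
  · simp [h1]
  · have h2 : 1 - y ≠ 0 := sub_ne_zero.2 (Ne.symm h1)
    have h3 : 1 - y⁻¹ ≠ 0 := sub_ne_zero.2 (by simpa [eq_comm] using h1)
    rw [div_eq_div_iff h3 h2]
    field_simp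
    ring

lemma rootFrac_eq_flip (h0 : η ≠ 0) (hη : η ^ n = -1) {a a' b b' : ℤ} (u v : ℤ)
    (ha : a + n + 2 * b' = a' + 2 * n * u) (hb : b = -b' + n * v) :
    rootFrac η a b = rootFrac η a' b' := by
  rw [rootFrac_eq h0 hη 0 v (a' := a) (by ring) hb, rootFrac_flip h0 hη]
  exact rootFrac_eq h0 hη u 0 ha (by ring)

/-- Encoding the sign as η^(n(i+1)) reduces later comparisons of terms to congruences between
exponents. -/
lemma zpow_mul_altSum (h0 : η ≠ 0) (hη : η ^ n = -1) (c : ℤ) (N M : ℕ) :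
    η ^ c * altSum (η ^ 3) N M = ∑ i ∈ Finset.range M,
      rootFrac η (c + n * (i + 1) + 3 * ((i + 1) * (i + 2 - 2 * N))) (3 * (i + 1)) := by
  rw [altSum, Finset.mul_sum]
  refine Finset.sum_congr rfl fun i _ => ?_
  have e : (n * (i + 1) : ℤ) = n * (i + 1 : ℕ) := by push_cast; rfl
  have e2 : (2 * (3 * (i + 1)) : ℤ) = (3 * (2 * (i + 1)) : ℕ) := by push_cast; ring
  rw [rootFrac, zpow_add₀ h0, zpow_add₀ h0, e, zpow_natCast_mul hη, zpow_mul η 3, e2,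
    zpow_natCast, pow_mul η 3]
  norm_cast
  ring

lemma sum_range_add_reflect {M : Type*} [AddCommMonoid M] (f : ℕ → M) (a b : ℕ) :
    ∑ i ∈ Finset.range (a + b), f i =
      ∑ m ∈ Finset.range a, f (a - 1 - m) + ∑ m ∈ Finset.range b, f (a + m) := by
  rw [Finset.sum_range_add, Finset.sum_range_reflect]

end RootFraction

/-! ### Central binomials to first order at a root of unity. -/

section CentralAtRoot

variable {η : ℂ} {n : ℕ}

/-- Descending induction from the top entry i = n - 1; since z^(2n-1) = z⁻¹, the adjacent ratio is a
signed power of z. -/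
lemma gaussBinom_at_root (hη : η ^ n = -1) (hp : IsPrimitiveRoot (η ^ 2) n) (h0 : η ≠ 0)
    (i d : ℕ) (hd : i + d + 1 = n) :
    gaussBinom (η ^ 2) (2 * n - 1) (n + i) = -η ^ (n * (i + 1) - i * (i + 1) : ℤ) := by
  induction d generalizing i with
  | zero =>
    rw [show 2 * n - 1 = n + i by omega, gaussBinom_self]
    have : (n * (i + 1) - i * (i + 1) : ℤ) = n := by
      have : (n : ℤ) = i + 1 := by omega
      rw [this]; ring
    rw [this, zpow_natCast, hη, neg_neg]
  | succ d ih =>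
    have h := gaussBinom_ratio (η ^ 2) (2 * n - 1) (n + i)
    have hi : n + i + 1 = n + (i + 1) := by ring
    rw [hi, ih (i + 1) (by omega)] at h
    have hpn : (η ^ 2) ^ n = 1 := hp.pow_eq_one
    have hq : (η ^ 2) ^ (2 * n - 1) * η ^ 2 = 1 := by
      rw [← pow_succ, show 2 * n - 1 + 1 = n * 2 by omega, pow_mul, hpn, one_pow]
    have h1 : (1 : ℂ) - (η ^ 2) ^ (i + 1) ≠ 0 :=
      sub_ne_zero.2 (hp.pow_ne_one_of_pos_of_lt (by omega) (by omega)).symm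
    rw [pow_add, pow_add _ n, hpn, one_mul, one_mul] at h
    have h2 : gaussBinom (η ^ 2) (2 * n - 1) (n + i) =
        (η ^ 2) ^ (i + 1) * η ^ (n * ((i + 1 : ℕ) + 1) - (i + 1 : ℕ) * ((i + 1 : ℕ) + 1) : ℤ) := by
      refine mul_left_cancel₀ h1 ?_
      generalize η ^ (n * ((i + 1 : ℕ) + 1) - (i + 1 : ℕ) * ((i + 1 : ℕ) + 1) : ℤ) = y at *
      rw [pow_succ _ i] at h1 ⊢
      linear_combination -η ^ 2 * h - gaussBinom (η ^ 2) (2 * n - 1) (n + i) * hq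
    rw [h2, ← pow_mul, ← zpow_natCast, ← zpow_add₀ h0, ← neg_one_mul, ← hη, ← zpow_natCast,
      ← zpow_add₀ h0]
    refine zpow_eq_of_eq_add h0 hη 0 ?_
    push_cast
    ring

lemma aeval_gaussBinom (z : ℂ) (N k : ℕ) :
    aeval z (gaussBinom (X : ℤ[X]) N k) = gaussBinom z N k := by
  have := map_gaussBinom (X : ℤ[X]) (aeval z).toRingHom N k
  simpa using this

lemma one_sub_X_pow_mul_central (j : ℕ) (hj : 0 < j) (hn : 0 < n) :
    (1 - X ^ (n + j)) * gaussBinom (X : ℤ[X]) (2 * n) (n + j) =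
      (1 - X ^ (2 * n)) * gaussBinom X (2 * n - 1) (n + (j - 1)) := by
  have h := one_sub_pow_mul_gaussBinom (X : ℤ[X]) (2 * n - 1) (n + (j - 1))
  rwa [show 2 * n - 1 + 1 = 2 * n by omega, show n + (j - 1) + 1 = n + j by omega] at h

lemma aeval_central (hp : IsPrimitiveRoot (η ^ 2) n) (j : ℕ) (hj : 0 < j) (hjn : j < n) :
    aeval (η ^ 2) (gaussBinom (X : ℤ[X]) (2 * n) (n + j)) = 0 := by
  have h := congrArg (aeval (η ^ 2)) (one_sub_X_pow_mul_central j hj (hj.trans hjn))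
  have h2 : (η ^ 2) ^ (2 * n) = 1 := by rw [mul_comm, pow_mul, hp.pow_eq_one, one_pow]
  simp only [map_mul, map_sub, map_one, map_pow, aeval_X, pow_add _ n, h2, hp.pow_eq_one, one_mul,
    sub_self, zero_mul] at h
  exact (mul_eq_zero.1 h).resolve_left
    (sub_ne_zero.2 (hp.pow_ne_one_of_pos_of_lt hj.ne' hjn).symm)

/-- In the Euler derivative of `one_sub_X_pow_mul_central` at z, only the derivative of 1 - X^(2n)
survives on the right and that of the binomial on the left. -/
lemma eulerDeriv_central (hη : η ^ n = -1) (hp : IsPrimitiveRoot (η ^ 2) n) (h0 : η ≠ 0)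
    (e j : ℕ) (hj : 0 < j) (hjn : j < n) :
    eulerDeriv (η ^ 2) (X ^ e * gaussBinom (X : ℤ[X]) (2 * n) (n + j)) =
      2 * n * rootFrac η (2 * e + n * j - j * (j - 1)) j := by
  have h := congrArg (eulerDeriv (η ^ 2)) (one_sub_X_pow_mul_central j hj (hj.trans hjn))
  have hz := aeval_central hp j hj hjn
  have hb := gaussBinom_at_root hη hp h0 (j - 1) (n - j) (by omega)
  have h1 : (1 : ℂ) - (η ^ 2) ^ j ≠ 0 :=
    sub_ne_zero.2 (hp.pow_ne_one_of_pos_of_lt hj.ne' hjn).symm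
  rw [eulerDeriv_mul, eulerDeriv_mul, hz, aeval_gaussBinom, hb] at h
  have h2 : (η ^ 2) ^ (2 * n) = 1 := by rw [mul_comm, pow_mul, hp.pow_eq_one, one_pow]
  simp only [map_sub, map_one, map_pow, aeval_X, eulerDeriv_X_pow, eulerDeriv_one,
    pow_add (η ^ 2) n, h2, hp.pow_eq_one, one_mul, sub_self, zero_mul, mul_zero, mul_one,
    add_zero, zero_add] at h
  rw [eulerDeriv_mul, hz, mul_zero, zero_add, rootFrac, ← mul_div_assoc, map_pow, aeval_X,
    show (2 * (j : ℤ)) = ((2 * j : ℕ) : ℤ) by push_cast; rfl, zpow_natCast, pow_mul,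
    eq_div_iff h1, mul_assoc, mul_comm (eulerDeriv _ _), h,
    show (2 * e + n * j - j * (j - 1) : ℤ) = (2 * e : ℕ) + (n * j - j * (j - 1)) by push_cast; ring,
    zpow_add₀ h0, zpow_natCast, pow_mul]
  have e1 : (((j - 1 : ℕ) : ℤ)) = j - 1 := by omega
  rw [e1, sub_add_cancel, mul_comm ((j : ℤ) - 1)]
  push_cast
  ring

lemma aeval_central_pair (hp : IsPrimitiveRoot (η ^ 2) n) (a b j j' : ℕ)
    (hj : 0 < j) (hjn : j < n) (hj' : 0 < j') (hjn' : j' < n) :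
    aeval (η ^ 2) (X ^ a * (gaussBinom (X : ℤ[X]) (2 * n) (n + j) -
      X ^ b * gaussBinom X (2 * n) (n + j'))) = 0 := by
  simp [aeval_central hp j hj hjn, aeval_central hp j' hj' hjn']

lemma eulerDeriv_central_pair (hη : η ^ n = -1) (hp : IsPrimitiveRoot (η ^ 2) n) (h0 : η ≠ 0)
    (a b j j' : ℕ) (hj : 0 < j) (hjn : j < n) (hj' : 0 < j') (hjn' : j' < n) :
    eulerDeriv (η ^ 2) (X ^ a * (gaussBinom (X : ℤ[X]) (2 * n) (n + j) -
      X ^ b * gaussBinom X (2 * n) (n + j'))) =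
      2 * n * (rootFrac η (2 * a + n * j - j * (j - 1)) j -
        rootFrac η (2 * (a + b) + n * j' - j' * (j' - 1)) j') := by
  rw [mul_sub, ← mul_assoc, ← pow_add, map_sub, eulerDeriv_central hη hp h0 _ _ hj hjn,
    eulerDeriv_central hη hp h0 _ _ hj' hjn']
  push_cast
  ring

end CentralAtRoot

/-! ### Euler derivatives of the expanded sums. -/

/-- The polynomial `∑ X^k [2k, k + s]` over `0 ≤ k < n`. -/
noncomputable def centralSum (s n : ℕ) : ℤ[X] :=
  ∑ k ∈ Finset.range n, X ^ k * gaussBinom X (2 * k) (k + s)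

/-- The summand of the expansion of `centralSum s n` in Gaussian binomials with top `2n`. -/
noncomputable def centralPair (s n m : ℕ) : ℤ[X] :=
  X ^ (6 * m ^ 2 + 4 * s * m + (3 * m + s)) *
    (gaussBinom X (2 * n) (n + (3 * m + s + 1)) -
      X ^ (2 * (3 * m + s) + 3) * gaussBinom X (2 * n) (n + (3 * m + s + 2)))

lemma centralSum_eq_sum_centralPair (s M n : ℕ) (hn : n ≤ 3 * M + s) :
    centralSum s n = ∑ m ∈ Finset.range M, centralPair s n m :=
  sum_gaussBinom_central X_ne_zero s M n hn

section PairSums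

variable {η : ℂ} {n : ℕ}

lemma aeval_sum_centralPair (hp : IsPrimitiveRoot (η ^ 2) n) (s M : ℕ) (hM : 3 * M + s ≤ n) :
    aeval (η ^ 2) (∑ m ∈ Finset.range M, centralPair s n m) = 0 := by
  rw [map_sum]
  refine Finset.sum_eq_zero fun m hm => ?_
  have hm := Finset.mem_range.1 hm
  exact aeval_central_pair hp _ _ _ _ (by omega) (by omega) (by omega) (by omega)

/-- The exponent of `η` in the first fraction coming from `centralPair s n m`. -/
def leftExp (s n m : ℤ) : ℤ :=
  2 * (6 * m ^ 2 + 4 * s * m + (3 * m + s)) + n * (3 * m + s + 1) - (3 * m + s + 1) * (3 * m + s)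

/-- The exponent of `η` in the second fraction coming from `centralPair s n m`. -/
def rightExp (s n m : ℤ) : ℤ :=
  2 * (6 * m ^ 2 + 4 * s * m + (3 * m + s) + (2 * (3 * m + s) + 3)) +
    n * (3 * m + s + 2) - (3 * m + s + 2) * (3 * m + s + 1)

lemma eulerDeriv_sum_centralPair (hη : η ^ n = -1) (hp : IsPrimitiveRoot (η ^ 2) n) (h0 : η ≠ 0)
    (s M : ℕ) (hM : 3 * M + s ≤ n) :
    eulerDeriv (η ^ 2) (∑ m ∈ Finset.range M, centralPair s n m) =
      2 * n * ∑ m ∈ Finset.range M, (rootFrac η (leftExp s n m) (3 * m + s + 1) -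
        rootFrac η (rightExp s n m) (3 * m + s + 2)) := by
  rw [map_sum, Finset.mul_sum]
  refine Finset.sum_congr rfl fun m hm => ?_
  have hm := Finset.mem_range.1 hm
  rw [centralPair, eulerDeriv_central_pair hη hp h0 _ _ _ _ (by omega) (by omega) (by omega)
    (by omega), leftExp, rightExp]
  congr 3 <;> push_cast <;> ring

lemma isPrimitiveRoot_cube (hp : IsPrimitiveRoot (η ^ 2) n) (h3 : n % 3 ≠ 0) :
    IsPrimitiveRoot ((η ^ 3) ^ 2) n := by
  rw [← pow_mul, mul_comm, pow_mul]
  refine hp.pow_of_coprime 3 ?_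
  rw [Nat.Prime.coprime_iff_not_dvd Nat.prime_three]
  omega

end PairSums

/-! ### Fraction sums for n = 3N + 1. -/

section OneModThree

variable {η : ℂ} {N n : ℕ}

/-- Modulo n, 3m + 1 ≡ -3(N - m) and 3m + 2 ≡ 3(N + m + 1), so the two families fill the lower and
upper halves of the alternating sum. -/
lemma sum_rootFrac_zero_one_mod (hη : η ^ n = -1) (hp : IsPrimitiveRoot (η ^ 2) n) (h0 : η ≠ 0)
    (hn : n = 3 * N + 1) :
    ∑ m ∈ Finset.range N, (rootFrac η (leftExp 0 n m) (3 * m + 0 + 1) -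
      rootFrac η (rightExp 0 n m) (3 * m + 0 + 2)) = -((η ^ 2) ^ N * (N / 2)) := by
  have hA := altSum_of_isPrimitiveRoot N (h := η ^ 3)
    (hn ▸ isPrimitiveRoot_cube hp (by omega))
  have hT := zpow_mul_altSum h0 hη (2 * N) N (2 * N)
  have e : (η : ℂ) ^ (2 * N : ℤ) = (η ^ 2) ^ N := by
    rw [← pow_mul, ← zpow_natCast]; push_cast; rfl
  rw [hA, e, two_mul N, sum_range_add_reflect, ← Finset.sum_add_distrib] at hT
  rw [← mul_neg, hT]
  refine Finset.sum_congr rfl fun m hm => ?_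
  have hm := Finset.mem_range.1 hm
  have hc : ((N - 1 - m : ℕ) : ℤ) = N - 1 - m := by omega
  rw [sub_eq_add_neg, rootFrac_neg h0 hη, hc, hn, leftExp, rightExp]
  congr 1
  · exact rootFrac_eq_flip (n := 3 * N + 1) h0 (hn ▸ hη) (2 * m + 1) 1
      (by push_cast; ring) (by push_cast; ring)
  · exact rootFrac_eq (n := 3 * N + 1) h0 (hn ▸ hη) m (-1)
      (by push_cast; ring) (by push_cast; ring)

lemma sum_rootFrac_one_one_mod (hη : η ^ n = -1) (hp : IsPrimitiveRoot (η ^ 2) n) (h0 : η ≠ 0)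
    (hn : n = 3 * N + 1) :
    η ^ 2 * ∑ m ∈ Finset.range N, (rootFrac η (leftExp 1 n m) (3 * m + 1 + 1) -
      rootFrac η (rightExp 1 n m) (3 * m + 1 + 2)) = N / 2 := by
  have hA := altSum_of_isPrimitiveRoot N (h := η ^ 3)
    (hn ▸ isPrimitiveRoot_cube hp (by omega))
  have hT := zpow_mul_altSum h0 hη (n - 2) N (2 * N)
  have e : η ^ 2 * η ^ (n - 2 : ℤ) = -1 := by
    rw [← hη, ← zpow_natCast, ← zpow_natCast, ← zpow_add₀ h0]
    congr 1
    push_cast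
    ring
  rw [hA, two_mul N, Finset.sum_range_add,
    ← Finset.sum_range_reflect (fun x => rootFrac _ _ (3 * (((N + x : ℕ) : ℤ) + 1))),
    ← Finset.sum_add_distrib] at hT
  have hS : ∑ m ∈ Finset.range N, (rootFrac η (leftExp 1 n m) (3 * m + 1 + 1) -
      rootFrac η (rightExp 1 n m) (3 * m + 1 + 2)) = η ^ (n - 2 : ℤ) * -(N / 2) := by
    rw [hT]
    refine Finset.sum_congr rfl fun m hm => ?_
    have hm := Finset.mem_range.1 hm
    -- Here 3m + 3 is already a multiple of 3 and 3m + 2 ≡ -3(2N - m), so the halves swap roles.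
    have hc : ((N + (N - 1 - m) : ℕ) : ℤ) = 2 * N - 1 - m := by omega
    rw [sub_eq_add_neg, rootFrac_neg h0 hη, hc, hn, leftExp, rightExp, add_comm]
    congr 1
    · exact rootFrac_eq (n := 3 * N + 1) h0 (hn ▸ hη) (2 * m + 2) 0
        (by push_cast; ring) (by push_cast; ring)
    · exact rootFrac_eq_flip (n := 3 * N + 1) h0 (hn ▸ hη) (3 * m + 2 - N) 2
        (by push_cast; ring) (by push_cast; ring)
  rw [hS, ← mul_assoc, e]
  ring

end OneModThree

/-! ### Fraction sums for n = 3N + 2. -/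

section TwoModThree

variable {η : ℂ} {N n : ℕ}

/-- The left fraction at m = N stands alone: its partner would have index n, where the denominator
vanishes. -/
lemma sum_rootFrac_zero_two_mod (hη : η ^ n = -1) (hp : IsPrimitiveRoot (η ^ 2) n) (h0 : η ≠ 0)
    (hn : n = 3 * N + 2) :
    (η ^ 2) ^ (N + 1) * (∑ m ∈ Finset.range N, (rootFrac η (leftExp 0 n m) (3 * m + 0 + 1) -
      rootFrac η (rightExp 0 n m) (3 * m + 0 + 2)) +
        rootFrac η (leftExp 0 n N) (3 * N + 0 + 1)) = (N + 1) / 2 := by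
  have hA := altSum_succ_of_isPrimitiveRoot N (h := η ^ 3)
    (hn ▸ isPrimitiveRoot_cube hp (by omega))
  have hT := zpow_mul_altSum h0 hη (n - 2 * (N + 1)) (N + 1) (2 * N + 1)
  have e : (η ^ 2) ^ (N + 1) * η ^ (n - 2 * (N + 1) : ℤ) = -1 := by
    rw [← hη, ← pow_mul, ← zpow_natCast, ← zpow_natCast, ← zpow_add₀ h0]
    congr 1
    push_cast
    ring
  rw [hA, show 2 * N + 1 = N + (N + 1) by ring, sum_range_add_reflect, Finset.sum_range_succ,
    ← add_assoc, ← Finset.sum_add_distrib] at hT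
  have hS : ∑ m ∈ Finset.range N, (rootFrac η (leftExp 0 n m) (3 * m + 0 + 1) -
      rootFrac η (rightExp 0 n m) (3 * m + 0 + 2)) + rootFrac η (leftExp 0 n N) (3 * N + 0 + 1) =
      η ^ (n - 2 * (N + 1) : ℤ) * -((N + 1) / 2) := by
    have hleft : ∀ m : ℕ, rootFrac η (leftExp 0 n m) (3 * m + 0 + 1) =
        rootFrac η (n - 2 * (N + 1) + n * ((N + m : ℕ) + 1) +
          3 * (((N + m : ℕ) + 1) * ((N + m : ℕ) + 2 - 2 * (N + 1 : ℕ))))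
          (3 * ((N + m : ℕ) + 1)) := by
      intro m
      rw [hn, leftExp]
      exact rootFrac_eq (n := 3 * N + 2) h0 (hn ▸ hη) m (-1)
        (by push_cast; ring) (by push_cast; ring)
    rw [hT, hleft]
    congr 1
    refine Finset.sum_congr rfl fun m hm => ?_
    have hm := Finset.mem_range.1 hm
    have hc : ((N - 1 - m : ℕ) : ℤ) = N - 1 - m := by omega
    rw [sub_eq_add_neg, rootFrac_neg h0 hη, hc, hleft, add_comm]
    congr 1
    rw [hn, rightExp]
    exact rootFrac_eq_flip (n := 3 * N + 2) h0 (hn ▸ hη) (2 * m + 3) 1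
      (by push_cast; ring) (by push_cast; ring)
  rw [hS, ← mul_assoc, e]
  ring

/-- As 3m + 2 = n - 3(N - m), left fractions are right fractions in reverse order. -/
lemma sum_rootFrac_one_two_mod (hη : η ^ n = -1) (h0 : η ≠ 0) (hn : n = 3 * N + 2) :
    ∑ m ∈ Finset.range N, (rootFrac η (leftExp 1 n m) (3 * m + 1 + 1) -
      rootFrac η (rightExp 1 n m) (3 * m + 1 + 2)) = 0 := by
  rw [Finset.sum_sub_distrib, sub_eq_zero]
  conv_rhs => rw [← Finset.sum_range_reflect]
  refine Finset.sum_congr rfl fun m hm => ?_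
  have hm := Finset.mem_range.1 hm
  have hc : ((N - 1 - m : ℕ) : ℤ) = N - 1 - m := by omega
  rw [hc, hn, leftExp, rightExp]
  exact rootFrac_eq_flip (n := 3 * N + 2) h0 (hn ▸ hη) (4 * m + 2 - 2 * N) 1
    (by push_cast; ring) (by push_cast; ring)

end TwoModThree

/-! ### Values and derivatives assembled in each residue class. -/

section Assembly

variable {η : ℂ} {N n : ℕ}

lemma pow_eq_pow_add_mul {z : ℂ} (hz : z ^ n = 1) (a k : ℕ) : z ^ (a + n * k) = z ^ a := by
  rw [pow_add, pow_mul, hz, one_pow, mul_one]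

lemma centralPair_last_left (s m : ℕ) :
    centralPair s (3 * m + s + 1) m = X ^ (6 * m ^ 2 + 4 * s * m + (3 * m + s)) := by
  rw [centralPair, ← two_mul, gaussBinom_self, gaussBinom_eq_zero _ (by omega)]
  ring

lemma centralPair_last_right (s m : ℕ) :
    centralPair s (3 * m + s + 2) m =
      X ^ (6 * m ^ 2 + 4 * s * m + (3 * m + s)) *
        gaussBinom X (2 * (3 * m + s + 2)) (3 * m + s + 2 + (3 * m + s + 1)) -
      X ^ (6 * m ^ 2 + 4 * s * m + (3 * m + s) + (2 * (3 * m + s) + 3)) := by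
  rw [centralPair, ← two_mul, gaussBinom_self]
  ring

lemma cyclotomic_sq_dvd_one_mod (hη : η ^ n = -1) (hp : IsPrimitiveRoot (η ^ 2) n) (h0 : η ≠ 0)
    (hn : n = 3 * N + 1) :
    cyclotomic n ℤ ^ 2 ∣ centralSum 0 n - X * centralSum 1 n -
      (X ^ (3 * N ^ 2 + 2 * N) - (N : ℤ[X]) * (X ^ n - 1)) := by
  have hz : (η ^ 2) ^ n = 1 := hp.pow_eq_one
  have hc0 : centralSum 0 n = ∑ m ∈ Finset.range N, centralPair 0 n m +
      X ^ (6 * N ^ 2 + 3 * N) := by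
    rw [centralSum_eq_sum_centralPair 0 (N + 1) n (by omega), Finset.sum_range_succ]
    congr 1
    rw [hn, centralPair_last_left 0 N]
    congr 1
    ring
  have hc1 := centralSum_eq_sum_centralPair 1 N n (by omega)
  have a0 := aeval_sum_centralPair hp 0 N (by omega)
  have a1 := aeval_sum_centralPair hp 1 N (by omega)
  have d0 := eulerDeriv_sum_centralPair hη hp h0 0 N (by omega)
  have d1 := eulerDeriv_sum_centralPair hη hp h0 1 N (by omega)
  have s0 := sum_rootFrac_zero_one_mod hη hp h0 hn
  have s1 := sum_rootFrac_one_one_mod hη hp h0 hn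
  push_cast at d0 d1
  rw [s0] at d0
  have e1 : (η ^ 2) ^ (6 * N ^ 2 + 3 * N) = (η ^ 2) ^ N := by
    rw [← pow_eq_pow_add_mul hz N (2 * N), hn]; congr 1; ring
  have e2 : (η ^ 2) ^ (3 * N ^ 2 + 2 * N) = (η ^ 2) ^ N := by
    rw [← pow_eq_pow_add_mul hz N N, hn]; congr 1; ring
  have hnC : (n : ℂ) = 3 * N + 1 := by rw [hn]; push_cast; ring
  refine cyclotomic_sq_dvd (by omega) hp ?_ ?_
  · rw [hc0, hc1]
    simp only [map_sub, map_add, map_mul, a0, a1, map_pow, aeval_X, map_natCast, map_one, hz,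
      e1, e2]
    ring
  · rw [hc0, hc1]
    simp only [map_sub, map_add, eulerDeriv_mul, a1, d0, d1, eulerDeriv_X_pow, eulerDeriv_natCast,
      eulerDeriv_one, eulerDeriv_X, map_natCast, aeval_X, e1, e2, hz]
    push_cast
    -- The s = 1 part contributes -nN, cancelled by the correction N(X^n - 1); the s = 0 fractions
    -- account for the two monomial exponents differing by nN.
    linear_combination -2 * n * s1 + (-((η ^ 2) ^ N * N)) * hnC

lemma cyclotomic_sq_dvd_two_mod (hη : η ^ n = -1) (hp : IsPrimitiveRoot (η ^ 2) n) (h0 : η ≠ 0)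
    (hn : n = 3 * N + 2) :
    cyclotomic n ℤ ^ 2 ∣ centralSum 0 n - X * centralSum 1 n -
      (-X ^ (3 * N ^ 2 + 4 * N + 1) - X ^ (6 * N ^ 2 + 7 * N + 2)) := by
  have hz : (η ^ 2) ^ n = 1 := hp.pow_eq_one
  have hc0 : centralSum 0 n = ∑ m ∈ Finset.range N, centralPair 0 n m +
      (X ^ (6 * N ^ 2 + 3 * N) * gaussBinom X (2 * n) (n + (3 * N + 1)) -
        X ^ (6 * N ^ 2 + 9 * N + 3)) := by
    rw [centralSum_eq_sum_centralPair 0 (N + 1) n (by omega), Finset.sum_range_succ]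
    congr 1
    rw [hn, centralPair_last_right 0 N]
    congr 2 <;> ring
  have hc1 : centralSum 1 n = ∑ m ∈ Finset.range N, centralPair 1 n m +
      X ^ (6 * N ^ 2 + 7 * N + 1) := by
    rw [centralSum_eq_sum_centralPair 1 (N + 1) n (by omega), Finset.sum_range_succ]
    congr 1
    rw [hn, centralPair_last_left 1 N]
    congr 1
    ring
  have a0 := aeval_sum_centralPair hp 0 N (by omega)
  have a1 := aeval_sum_centralPair hp 1 N (by omega)
  have d0 := eulerDeriv_sum_centralPair hη hp h0 0 N (by omega)
  have d1 := eulerDeriv_sum_centralPair hη hp h0 1 N (by omega)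
  have s0 := sum_rootFrac_zero_two_mod hη hp h0 hn
  have s1 := sum_rootFrac_one_two_mod hη h0 hn
  have ab := aeval_central hp (3 * N + 1) (by omega) (by omega)
  have db : eulerDeriv (η ^ 2) (X ^ (6 * N ^ 2 + 3 * N) *
      gaussBinom (X : ℤ[X]) (2 * n) (n + (3 * N + 1))) =
      2 * n * rootFrac η (leftExp 0 n N) (3 * N + 0 + 1) := by
    rw [eulerDeriv_central hη hp h0 _ _ (by omega) (by omega), leftExp]
    congr 2; push_cast; ring
  push_cast at d0 d1
  rw [s1, mul_zero] at d1
  have hnC : (n : ℂ) = 3 * N + 2 := by rw [hn]; push_cast; ring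
  -- The exponents differ by n(N + 1): the values at z agree, and the s = 0 fractions make up the
  -- difference in derivative.
  have e1 : (η ^ 2) ^ (6 * N ^ 2 + 9 * N + 3) = (η ^ 2) ^ (3 * N ^ 2 + 4 * N + 1) := by
    rw [← pow_eq_pow_add_mul hz (3 * N ^ 2 + 4 * N + 1) (N + 1), hn]; congr 1; ring
  have e2 : (η ^ 2) ^ (3 * N ^ 2 + 4 * N + 1) * (η ^ 2) ^ (N + 1) = 1 := by
    rw [← pow_add, show 3 * N ^ 2 + 4 * N + 1 + (N + 1) = n * (N + 1) by rw [hn]; ring, pow_mul, hz,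
      one_pow]
  refine cyclotomic_sq_dvd (by omega) hp ?_ ?_
  · rw [hc0, hc1]
    simp only [map_sub, map_add, map_mul, map_neg, a0, a1, ab, map_pow, aeval_X, e1]
    ring
  · rw [hc0, hc1]
    simp only [map_sub, map_add, map_neg, db]
    simp only [eulerDeriv_mul, map_add, a1, d0, d1, eulerDeriv_X_pow, eulerDeriv_X, aeval_X,
      map_pow, e1]
    push_cast
    set t := (η ^ 2) ^ (3 * N ^ 2 + 4 * N + 1)
    generalize (∑ m ∈ Finset.range N, (rootFrac η (leftExp 0 n m) (3 * m + 0 + 1) -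
      rootFrac η (rightExp 0 n m) (3 * m + 0 + 2))) = S at *
    generalize rootFrac η (leftExp 0 n N) (3 * N + 0 + 1) = r at *
    linear_combination 2 * n * t * s0 - 2 * n * (S + r) * e2 + t * (N + 1) * hnC

end Assembly

end QCatalan

/-! ### The theorem, with η a primitive 2n-th root of unity. -/

theorem theorem1 (n : ℕ) (hn : 0 < n) :
    (n % 3 = 2 →
      QCatalan.QCongr
        (∑ k ∈ Finset.range n, QCatalan.q ^ k * QCatalan.qCatalan k)
        (-QCatalan.q ^ ((n ^ 2 - 1) / 3) - QCatalan.q ^ (n * (2 * n - 1) / 3))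
        (Polynomial.cyclotomic n ℤ ^ 2)) ∧
    (n % 3 = 1 →
      QCatalan.QCongr
        (∑ k ∈ Finset.range n, QCatalan.q ^ k * QCatalan.qCatalan k)
        (QCatalan.q ^ ((n ^ 2 - 1) / 3)
          - ((n : RatFunc ℤ) - 1) / 3 * (QCatalan.q ^ n - 1))
        (Polynomial.cyclotomic n ℤ ^ 2)) := by
  have hprim := Complex.isPrimitiveRoot_exp (2 * n) (by omega)
  generalize Complex.exp (2 * Real.pi * Complex.I / (2 * n : ℕ)) = η at hprim
  have h0 : η ≠ 0 := hprim.ne_zero (by omega)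
  have hp : IsPrimitiveRoot (η ^ 2) n := hprim.pow (by omega) rfl
  have hη : η ^ n = -1 := (hprim.pow (by omega) (mul_comm 2 n)).eq_neg_one_of_two_right
  refine ⟨fun h => ?_, fun h => ?_⟩
  · obtain ⟨N, hN⟩ : ∃ N, n = 3 * N + 2 := ⟨n / 3, by omega⟩
    obtain ⟨g, hg⟩ := QCatalan.cyclotomic_sq_dvd_two_mod hη hp h0 hN
    refine ⟨g, ?_⟩
    have e1 : (n ^ 2 - 1) / 3 = 3 * N ^ 2 + 4 * N + 1 := by
      rw [hN, show (3 * N + 2) ^ 2 = 3 * (3 * N ^ 2 + 4 * N + 1) + 1 by ring]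
      omega
    have e2 : n * (2 * n - 1) / 3 = 6 * N ^ 2 + 7 * N + 2 := by
      rw [hN, show 2 * (3 * N + 2) - 1 = 3 * (2 * N + 1) by omega,
        show (3 * N + 2) * (3 * (2 * N + 1)) = 3 * (6 * N ^ 2 + 7 * N + 2) by ring]
      omega
    rw [← hg, QCatalan.sum_qCatalan_eq, e1, e2, map_sub _ (_ - _)]
    simp [QCatalan.centralSum, QCatalan.q]
  · obtain ⟨N, hN⟩ : ∃ N, n = 3 * N + 1 := ⟨n / 3, by omega⟩
    obtain ⟨g, hg⟩ := QCatalan.cyclotomic_sq_dvd_one_mod hη hp h0 hN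
    refine ⟨g, ?_⟩
    have e1 : (n ^ 2 - 1) / 3 = 3 * N ^ 2 + 2 * N := by
      rw [hN, show (3 * N + 1) ^ 2 = 3 * (3 * N ^ 2 + 2 * N) + 1 by ring]
      omega
    have e2 : ((n : RatFunc ℤ) - 1) / 3 = N := by
      have h3 : (3 : RatFunc ℤ) ≠ 0 := by
        have h3' : (Polynomial.C 3 : ℤ[X]) ≠ 0 := Polynomial.C_ne_zero.2 (by norm_num)
        have := (map_ne_zero_iff _ (IsFractionRing.injective ℤ[X] (RatFunc ℤ))).2 h3'
        rwa [map_ofNat Polynomial.C 3, map_ofNat] at this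
      rw [div_eq_iff h3, hN]
      push_cast
      ring
    rw [← hg, QCatalan.sum_qCatalan_eq, e1, e2, map_sub _ (_ - _)]
    simp [QCatalan.centralSum, QCatalan.q]
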